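/- Let $\mathfrak N$ be a finite dimensional real 2-step nilpotent (hence non-abelian) Lie algebra with an inner product $\langle\,,\rangle$, and let $N$ be the simply connected Lie group with Lie algebra $\mathfrak N$, with the corresponding left invariant Riemannian metric. Let $\mathfrak Z$ be the center of $\mathfrak N$ and $\mathfrak V=\mathfrak Z^\perp$. Let $Z\in[\mathfrak N,\mathfrak N]$ be nonzero, let $j(Z):\mathfrak V\to\mathfrak V$ be the skew symmetric map with $\langle j(Z)X,Y\rangle=\langle[X,Y],Z\rangle$, let $R_Z(X)=R(X,Z)Z$, where $R$ is the Riemann curvature tensor of $N$ at the identity, and let $\gamma(t)=\gamma_Z(t)=\exp(tZ)$. Let $\pm i\lambda_1,\dots,\pm i\lambda_M$ (with $\lambda_j>0$, not necessarily distinct) be the nonzero eigenvalues of $j(Z)$, counted with multiplicity. Then $\mathfrak N$ has a basis $$\{A_1,\dots,A_r,\;B_1,\dots,B_M,\;j(Z)B_1,\dots,j(Z)B_M,\;Z_1,\dots,Z_s\}$$ with $A_i,B_j\in\mathfrak V$, $\operatorname{span}\{A_i\}=\ker j(Z)$, $\operatorname{span}\{Z_\alpha\}=\mathfrak Z$ and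 $R_Z(B_j)=\tfrac14\lambda_j^2B_j$ for all $j$. For any such basis, regard elements of $\mathfrak N$ as left invariant vector fields on $N$ and put, for $1\le j\le M$, $$\xi_j(t)=(\cos(\lambda_jt)-1)\,B_j(\gamma(t))+\tfrac1{\lambda_j}\sin(\lambda_jt)\,(j(Z)B_j)(\gamma(t)),$$ $$\eta_j(t)=\sin(\lambda_jt)\,B_j(\gamma(t))+\tfrac1{\lambda_j}(1-\cos(\lambda_jt))\,(j(Z)B_j)(\gamma(t)).$$ Let $t_0>0$, let $J_{t_0}(\gamma)$ be the real vector space of Jacobi fields $Y$ along $\gamma$ with $Y(0)=0$ and $Y(t_0)=0$, and let $I=\{j: 1\le j\le M,\ t_0=2\pi m/\lambda_j\text{ for some positive integer }m\}$. Then $$J_{t_0}(\gamma)=\mathbb R\text{-span}\{\xi_j,\eta_j: j\in I\}.$$ Moreover $\dim J_{t_0}(\gamma)$ is even for every $t_0>0$; in particular every point $\gamma(t_0)$, $t_0>0$, conjugate to $\gamma(0)$ along $\gamma$ has even multiplicity. -/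

import Mathlib

open scoped ContDiff

set_option maxSynthPendingDepth 3

noncomputable section

namespace CentralConjugate

/-! ## Riemannian geometry in a global coordinate chart

The manifold is a finite dimensional real vector space `E`; every tangent space is identified
with `E` by the linear coordinates. -/

section Riemannian

/-- A smooth Riemannian metric on (the manifold) `E`. -/
structure RiemannianMetric (E : Type*) [NormedAddCommGroup E] [NormedSpace ℝ E] where
  /-- the bilinear form on the tangent space at a point -/
  form : E → E →L[ℝ] E →L[ℝ] ℝ
  symm : ∀ p u v, form p u v = form p v u
  pos : ∀ p u, u ≠ 0 → 0 < form p u u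
  smooth : ContDiff ℝ ∞ form

variable {E : Type*} [NormedAddCommGroup E] [NormedSpace ℝ E]

namespace RiemannianMetric

/-- The Christoffel symbol of the first kind: the functional
`w ↦ (1/2) (∂ᵤ g(v, w) + ∂ᵥ g(u, w) - ∂_w g(u, v))`. -/
def christoffelFirst (g : RiemannianMetric E) (p : E) (u v : E) : E →L[ℝ] ℝ :=
  (1 / 2 : ℝ) • (fderiv ℝ g.form p u v + fderiv ℝ g.form p v u
    - ((fderiv ℝ g.form p).flip u).flip v)

/-- The Christoffel symbol of the Levi-Civita connection: `Γₚ(u, v)` is the vector with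
`gₚ(Γₚ(u, v), w) = (1/2) (∂ᵤ g(v, w) + ∂ᵥ g(u, w) - ∂_w g(u, v))`. -/
def christoffel (g : RiemannianMetric E) (p : E) (u v : E) : E :=
  (g.form p).inverse (g.christoffelFirst p u v)

/-- The Riemann curvature tensor
`R(u, v)w = ∇ᵤ∇ᵥ w - ∇ᵥ∇ᵤ w - ∇_[u, v] w` in coordinates. -/
def curvature (g : RiemannianMetric E) (p : E) (u v w : E) : E :=
  fderiv ℝ (fun q => g.christoffel q v w) p u - fderiv ℝ (fun q => g.christoffel q u w) p v
    + g.christoffel p u (g.christoffel p v w) - g.christoffel p v (g.christoffel p u w)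

/-- The covariant derivative of a vector field `Y` along the curve `γ`. -/
def covDeriv (g : RiemannianMetric E) (γ Y : ℝ → E) (t : ℝ) : E :=
  deriv Y t + g.christoffel (γ t) (deriv γ t) (Y t)

/-- `Y` is a Jacobi field along `γ`: it is smooth and `Y'' + R(Y, γ')γ' = 0`. -/
def IsJacobiField (g : RiemannianMetric E) (γ Y : ℝ → E) : Prop :=
  ContDiff ℝ ∞ Y ∧ ∀ t, g.covDeriv γ (g.covDeriv γ Y) t
    + g.curvature (γ t) (Y t) (deriv γ t) (deriv γ t) = 0

theorem isInvertible_form [FiniteDimensional ℝ E] (g : RiemannianMetric E) (p : E) :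
    (g.form p).IsInvertible := by
  have hinj : Function.Injective (g.form p).toLinearMap := by
    rw [← LinearMap.ker_eq_bot, LinearMap.ker_eq_bot']
    intro u hu
    by_contra hne
    have h := g.pos p u hne
    have h0 : g.form p u = 0 := hu
    rw [h0] at h
    simp at h
  have hdim : Module.finrank ℝ E = Module.finrank ℝ (E →L[ℝ] ℝ) := by
    rw [← (LinearMap.toContinuousLinearMap (𝕜 := ℝ) (E := E) (F' := ℝ)).finrank_eq]
    exact (Subspace.dual_finrank_eq (K := ℝ) (V := E)).symm
  refine ⟨(LinearEquiv.ofInjectiveOfFinrankEq _ hinj hdim).toContinuousLinearEquiv, ?_⟩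
  ext u v
  rfl

theorem form_christoffel [FiniteDimensional ℝ E] (g : RiemannianMetric E) (p u v w : E) :
    g.form p (g.christoffel p u v) w =
      (1 / 2) * (fderiv ℝ g.form p u v w + fderiv ℝ g.form p v u w
        - fderiv ℝ g.form p w u v) := by
  have h : g.form p (g.christoffel p u v) = g.christoffelFirst p u v := by
    unfold christoffel
    obtain ⟨e, he⟩ := g.isInvertible_form p
    rw [← he, ContinuousLinearMap.inverse_equiv]
    simp
  rw [h]
  simp [christoffelFirst]

theorem christoffelFirst_add_right (g : RiemannianMetric E) (p u v v' : E) :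
    g.christoffelFirst p u (v + v') = g.christoffelFirst p u v + g.christoffelFirst p u v' := by
  ext w; simp [christoffelFirst]; ring

theorem christoffelFirst_smul_right (g : RiemannianMetric E) (p u v : E) (c : ℝ) :
    g.christoffelFirst p u (c • v) = c • g.christoffelFirst p u v := by
  ext w; simp [christoffelFirst]; ring

theorem christoffelFirst_add_left (g : RiemannianMetric E) (p u u' v : E) :
    g.christoffelFirst p (u + u') v = g.christoffelFirst p u v + g.christoffelFirst p u' v := by
  ext w; simp [christoffelFirst]; ring

theorem christoffelFirst_smul_left (g : RiemannianMetric E) (p u v : E) (c : ℝ) :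
    g.christoffelFirst p (c • u) v = c • g.christoffelFirst p u v := by
  ext w; simp [christoffelFirst]; ring

theorem christoffel_add_right (g : RiemannianMetric E) (p u v v' : E) :
    g.christoffel p u (v + v') = g.christoffel p u v + g.christoffel p u v' := by
  simp [christoffel, christoffelFirst_add_right]

theorem christoffel_smul_right (g : RiemannianMetric E) (p u v : E) (c : ℝ) :
    g.christoffel p u (c • v) = c • g.christoffel p u v := by
  simp [christoffel, christoffelFirst_smul_right]

theorem christoffel_add_left (g : RiemannianMetric E) (p u u' v : E) :
    g.christoffel p (u + u') v = g.christoffel p u v + g.christoffel p u' v := by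
  simp [christoffel, christoffelFirst_add_left]

theorem christoffel_smul_left (g : RiemannianMetric E) (p u v : E) (c : ℝ) :
    g.christoffel p (c • u) v = c • g.christoffel p u v := by
  simp [christoffel, christoffelFirst_smul_left]

/-- Christoffel symbols depend smoothly on the point and on both arguments. -/
theorem contDiff_christoffel [FiniteDimensional ℝ E] (g : RiemannianMetric E)
    {F : Type*} [NormedAddCommGroup F] [NormedSpace ℝ F] {p u v : F → E}
    (hp : ContDiff ℝ ∞ p) (hu : ContDiff ℝ ∞ u) (hv : ContDiff ℝ ∞ v) :
    ContDiff ℝ ∞ (fun x => g.christoffel (p x) (u x) (v x)) := by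
  have : CompleteSpace E := FiniteDimensional.complete ℝ E
  have hd : ContDiff ℝ ∞ (fun x => fderiv ℝ g.form (p x)) :=
    (g.smooth.fderiv_right (m := ∞) (by simp)).comp hp
  have hinv : ContDiff ℝ ∞ (fun x => (g.form (p x)).inverse) := by
    rw [contDiff_iff_contDiffAt]
    intro x
    obtain ⟨e, he⟩ := g.isInvertible_form (p x)
    have h1 : ContDiffAt ℝ ∞ (fun x => g.form (p x)) x := (g.smooth.comp hp).contDiffAt
    have h2 := contDiffAt_map_inverse (𝕜 := ℝ) (n := ∞) e
    rw [he] at h2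
    exact ContDiffAt.comp x h2 h1
  unfold christoffel
  refine hinv.clm_apply ?_
  unfold christoffelFirst
  have h3 : ContDiff ℝ ∞ (fun x => ((fderiv ℝ g.form (p x)).flip (u x)).flip (v x)) := by
    have a : ContDiff ℝ ∞ (fun x => (fderiv ℝ g.form (p x)).flip) :=
      (ContinuousLinearMap.flipₗᵢ ℝ E E (E →L[ℝ] ℝ)).toContinuousLinearEquiv.contDiff.comp hd
    have b := a.clm_apply hu
    have c : ContDiff ℝ ∞ (fun x => ((fderiv ℝ g.form (p x)).flip (u x)).flip) :=
      (ContinuousLinearMap.flipₗᵢ ℝ E E ℝ).toContinuousLinearEquiv.contDiff.comp b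
    exact c.clm_apply hv
  exact ContDiff.const_smul (1 / 2 : ℝ)
    ((((hd.clm_apply hu).clm_apply hv).add ((hd.clm_apply hv).clm_apply hu)).sub h3)

theorem differentiableAt_christoffel [FiniteDimensional ℝ E] (g : RiemannianMetric E)
    (p u v : E) : DifferentiableAt ℝ (fun q => g.christoffel q u v) p :=
  (g.contDiff_christoffel contDiff_id contDiff_const contDiff_const).differentiable
    (by simp) p

theorem curvature_add [FiniteDimensional ℝ E] (g : RiemannianMetric E) (p u u' v w : E) :
    g.curvature p (u + u') v w = g.curvature p u v w + g.curvature p u' v w := by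
  unfold curvature
  simp only [christoffel_add_left, christoffel_add_right, map_add]
  rw [fderiv_fun_add (g.differentiableAt_christoffel p u w)
    (g.differentiableAt_christoffel p u' w), _root_.add_apply]
  abel

theorem curvature_smul [FiniteDimensional ℝ E] (g : RiemannianMetric E) (p u v w : E) (c : ℝ) :
    g.curvature p (c • u) v w = c • g.curvature p u v w := by
  unfold curvature
  simp only [christoffel_smul_left, christoffel_smul_right, map_smul]
  rw [fderiv_fun_const_smul (g.differentiableAt_christoffel p u w),
    _root_.smul_apply]
  simp only [smul_sub, smul_add]

theorem contDiff_covDeriv [FiniteDimensional ℝ E] (g : RiemannianMetric E) {γ Y : ℝ → E}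
    (hγ : ContDiff ℝ ∞ γ) (hY : ContDiff ℝ ∞ Y) : ContDiff ℝ ∞ (g.covDeriv γ Y) :=
  (contDiff_infty_iff_deriv.1 hY).2.add
    (g.contDiff_christoffel hγ (contDiff_infty_iff_deriv.1 hγ).2 hY)

theorem covDeriv_add (g : RiemannianMetric E) {γ Y Y' : ℝ → E}
    (hY : ContDiff ℝ ∞ Y) (hY' : ContDiff ℝ ∞ Y') :
    g.covDeriv γ (Y + Y') = g.covDeriv γ Y + g.covDeriv γ Y' := by
  funext t
  have h := deriv_add (hY.differentiable (by simp) t) (hY'.differentiable (by simp) t)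
  simp only [covDeriv, Pi.add_apply, christoffel_add_right, h]
  abel

theorem covDeriv_smul (g : RiemannianMetric E) {γ Y : ℝ → E} (c : ℝ)
    (hY : ContDiff ℝ ∞ Y) : g.covDeriv γ (c • Y) = c • g.covDeriv γ Y := by
  funext t
  have h := deriv_const_smul c (hY.differentiable (by simp) t)
  simp only [covDeriv, Pi.smul_apply, christoffel_smul_right, h, smul_add]

/-- The vector space `J(γ)` of Jacobi fields along a smooth curve `γ`. -/
def jacobiFields [FiniteDimensional ℝ E] (g : RiemannianMetric E) (γ : ℝ → E)
    (hγ : ContDiff ℝ ∞ γ) : Submodule ℝ (ℝ → E) where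
  carrier := {Y | g.IsJacobiField γ Y}
  zero_mem' := by
    refine ⟨contDiff_const, fun t => ?_⟩
    have h0 : g.covDeriv γ 0 = 0 := by
      have := g.covDeriv_smul (γ := γ) (Y := 0) 0 contDiff_const
      simpa using this
    have h1 : g.curvature (γ t) 0 (deriv γ t) (deriv γ t) = 0 := by
      have := g.curvature_smul (γ t) 0 (deriv γ t) (deriv γ t) 0
      simpa using this
    rw [h0, h0, Pi.zero_apply, zero_add]
    exact h1
  add_mem' := by
    rintro Y Y' ⟨hY, hJ⟩ ⟨hY', hJ'⟩
    refine ⟨hY.add hY', fun t => ?_⟩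
    rw [g.covDeriv_add hY hY',
      g.covDeriv_add (g.contDiff_covDeriv hγ hY) (g.contDiff_covDeriv hγ hY'),
      Pi.add_apply, Pi.add_apply, curvature_add, add_add_add_comm, hJ t, hJ' t, add_zero]
  smul_mem' := by
    rintro c Y ⟨hY, hJ⟩
    refine ⟨contDiff_const.smul hY, fun t => ?_⟩
    rw [g.covDeriv_smul c hY, g.covDeriv_smul c (g.contDiff_covDeriv hγ hY),
      Pi.smul_apply, Pi.smul_apply, curvature_smul, ← smul_add, hJ t, smul_zero]

/-- The space of Jacobi fields along `γ` that vanish at `0` and at `t₀`. -/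
def jacobiFieldsVanishing [FiniteDimensional ℝ E] (g : RiemannianMetric E) (γ : ℝ → E)
    (hγ : ContDiff ℝ ∞ γ) (t₀ : ℝ) : Submodule ℝ (ℝ → E) where
  carrier := {Y | Y ∈ g.jacobiFields γ hγ ∧ Y 0 = 0 ∧ Y t₀ = 0}
  zero_mem' := ⟨Submodule.zero_mem _, rfl, rfl⟩
  add_mem' := by
    rintro Y Y' ⟨h, h0, h1⟩ ⟨h', h0', h1'⟩
    exact ⟨Submodule.add_mem _ h h', by simp [h0, h0'], by simp [h1, h1']⟩
  smul_mem' := by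
    rintro c Y ⟨h, h0, h1⟩
    exact ⟨Submodule.smul_mem _ c h, by simp [h0], by simp [h1]⟩

/-- The multiplicity of `γ t₀` as a point conjugate to `γ 0` along `γ`
(it is zero if and only if `γ t₀` is not conjugate to `γ 0`). -/
def conjugateMultiplicity [FiniteDimensional ℝ E] (g : RiemannianMetric E) (γ : ℝ → E)
    (hγ : ContDiff ℝ ∞ γ) (t₀ : ℝ) : ℕ :=
  Module.finrank ℝ (g.jacobiFieldsVanishing γ hγ t₀)

end RiemannianMetric

end Riemannian

/-! ## Metric two-step nilpotent Lie algebras and their simply connected groups -/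

/-- A real Lie algebra with an inner product. -/
class MetricLieAlgebra (𝔫 : Type*) extends NormedAddCommGroup 𝔫, LieRing 𝔫,
  InnerProductSpace ℝ 𝔫, LieAlgebra ℝ 𝔫

/-- Two-step nilpotent: `[[X, Y], W] = 0` for all `X, Y, W`, but not abelian. -/
class IsTwoStepNilpotent (𝔫 : Type*) [LieRing 𝔫] : Prop where
  lie_lie : ∀ X Y W : 𝔫, ⁅⁅X, Y⁆, W⁆ = 0
  not_abelian : ¬ IsLieAbelian 𝔫

section Nilpotent

variable {𝔫 : Type*} [MetricLieAlgebra 𝔫]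

/-- The multiplication of the simply connected Lie group `N` with Lie algebra `𝔫`, in the global
chart given by the diffeomorphism `exp : 𝔫 → N` (Baker-Campbell-Hausdorff):
`exp p * exp q = exp (p + q + (1/2) [p, q])`. -/
def groupMul (p q : 𝔫) : 𝔫 := p + q + (1 / 2 : ℝ) • ⁅p, q⁆

/-- The group `N`, with underlying set `𝔫`; the exponential map is the identity map. -/
abbrev simplyConnectedGroup (𝔫 : Type*) [MetricLieAlgebra 𝔫] [IsTwoStepNilpotent 𝔫] :
    Group 𝔫 where
  mul := groupMul
  one := 0
  inv p := -p
  mul_assoc p q r := by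
    have h1 : ∀ X Y W : 𝔫, ⁅⁅X, Y⁆, W⁆ = 0 := IsTwoStepNilpotent.lie_lie
    have h2 : ∀ X Y W : 𝔫, ⁅X, ⁅Y, W⁆⁆ = 0 := fun X Y W => by
      rw [← lie_skew, h1, neg_zero]
    change groupMul (groupMul p q) r = groupMul p (groupMul q r)
    simp only [groupMul, add_lie, lie_add, smul_lie, lie_smul, h1, h2, smul_zero, add_zero,
      smul_add]
    abel
  one_mul p := by
    change groupMul 0 p = p
    simp [groupMul]
  mul_one p := by
    change groupMul p 0 = p
    simp [groupMul]
  inv_mul_cancel p := by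
    change groupMul (-p) p = 0
    simp [groupMul]

/-- Left translation of `N` by `p`. -/
def leftTranslation (p : 𝔫) : 𝔫 → 𝔫 := fun q => groupMul p q

/-- The value at `p` of the left invariant vector field `X` on `N`, where `X` is an element of
the Lie algebra `𝔫 = T_e N`. -/
def leftInvariantField (X : 𝔫) (p : 𝔫) : 𝔫 := fderiv ℝ (leftTranslation p) 0 X

/-- The curve `γ_Z(t) = exp(tZ)`. -/
def centralGeodesic (Z : 𝔫) : ℝ → 𝔫 := fun t => t • Z

theorem contDiff_centralGeodesic (Z : 𝔫) : ContDiff ℝ ∞ (centralGeodesic Z) :=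
  contDiff_id.smul contDiff_const

/-- `γ_Z` is the one-parameter subgroup of `N` ... -/
theorem centralGeodesic_add (Z : 𝔫) (s t : ℝ) :
    centralGeodesic Z (s + t) = groupMul (centralGeodesic Z s) (centralGeodesic Z t) := by
  simp [centralGeodesic, groupMul, add_smul]

/-- ... with initial velocity `Z`. -/
theorem hasDerivAt_centralGeodesic (Z : 𝔫) (t : ℝ) : HasDerivAt (centralGeodesic Z) Z t := by
  have h : HasDerivAt (fun s : ℝ => s • Z) ((1 : ℝ) • Z) t := (hasDerivAt_id t).smul_const Z
  rw [one_smul] at h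
  exact h

/-- The inner product as a continuous bilinear map. -/
def innerL (𝔫 : Type*) [MetricLieAlgebra 𝔫] : 𝔫 →L[ℝ] 𝔫 →L[ℝ] ℝ := innerSL ℝ

@[simp] theorem innerL_apply (u v : 𝔫) : innerL 𝔫 u v = inner ℝ u v := rfl

variable [FiniteDimensional ℝ 𝔫]

/-- The Lie bracket as a continuous bilinear map. -/
def bracketL (𝔫 : Type*) [MetricLieAlgebra 𝔫] [FiniteDimensional ℝ 𝔫] : 𝔫 →L[ℝ] 𝔫 →L[ℝ] 𝔫 :=
  LinearMap.toContinuousLinearMap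
    ((LinearMap.toContinuousLinearMap (𝕜 := ℝ) (E := 𝔫) (F' := 𝔫)).toLinearMap ∘ₗ
      (LieModule.toEnd ℝ 𝔫 𝔫 : 𝔫 →ₗ[ℝ] Module.End ℝ 𝔫))

@[simp] theorem bracketL_apply (X Y : 𝔫) : bracketL 𝔫 X Y = ⁅X, Y⁆ := rfl

theorem fderiv_leftTranslation (p q : 𝔫) :
    fderiv ℝ (leftTranslation p) q =
      ContinuousLinearMap.id ℝ 𝔫 + (1 / 2 : ℝ) • bracketL 𝔫 p := by
  apply HasFDerivAt.fderiv
  have h : leftTranslation p = fun q => p + (ContinuousLinearMap.id ℝ 𝔫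
      + (1 / 2 : ℝ) • bracketL 𝔫 p) q := by
    funext q
    simp [leftTranslation, groupMul, add_assoc]
  rw [h]
  exact (ContinuousLinearMap.hasFDerivAt _).const_add p

/-- The left invariant Riemannian metric on `N` which is the given inner product on
`𝔫 = T_e N`: the inner product of `u, v ∈ T_p N` is that of their images under the differential
of left translation by `p⁻¹ = -p`. -/
def leftInvariantMetric (𝔫 : Type*) [MetricLieAlgebra 𝔫] [FiniteDimensional ℝ 𝔫]
    [IsTwoStepNilpotent 𝔫] : RiemannianMetric 𝔫 where
  form p := (innerL 𝔫).bilinearComp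
    (fderiv ℝ (leftTranslation (-p)) p) (fderiv ℝ (leftTranslation (-p)) p)
  symm p u v := by
    exact real_inner_comm _ _
  pos p u hu := by
    have hne : fderiv ℝ (leftTranslation (-p)) p u ≠ 0 := by
      rw [fderiv_leftTranslation]
      intro h
      have h1 : u + (1 / 2 : ℝ) • ⁅-p, u⁆ = 0 := h
      have h2 : ⁅p, u⁆ = 0 := by
        have h3 : ⁅p, u + (1 / 2 : ℝ) • ⁅-p, u⁆⁆ = 0 := by rw [h1, lie_zero]
        rw [lie_add, lie_smul, ← lie_skew p ⁅-p, u⁆, IsTwoStepNilpotent.lie_lie] at h3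
        simpa using h3
      rw [neg_lie, h2] at h1
      exact hu (by simpa using h1)
    exact real_inner_self_pos.2 hne
  smooth := by
    have hA : ContDiff ℝ ∞ (fun p : 𝔫 => fderiv ℝ (leftTranslation (-p)) p) := by
      simp only [fderiv_leftTranslation]
      have h : ContDiff ℝ ∞ (fun p : 𝔫 => bracketL 𝔫 (-p)) :=
        (bracketL 𝔫).contDiff.comp contDiff_neg
      exact contDiff_const.add (h.const_smul (1 / 2 : ℝ))
    have h1 : ContDiff ℝ ∞ (fun p : 𝔫 =>
        (innerL 𝔫).comp (fderiv ℝ (leftTranslation (-p)) p)) :=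
      contDiff_const.clm_comp hA
    have h2 : ContDiff ℝ ∞ (fun p : 𝔫 =>
        ((innerL 𝔫).comp (fderiv ℝ (leftTranslation (-p)) p)).flip) :=
      (ContinuousLinearMap.flipₗᵢ ℝ 𝔫 𝔫 ℝ).toContinuousLinearEquiv.contDiff.comp h1
    have h3 : ContDiff ℝ ∞ (fun p : 𝔫 =>
        (((innerL 𝔫).comp (fderiv ℝ (leftTranslation (-p)) p)).flip.comp
          (fderiv ℝ (leftTranslation (-p)) p)).flip) :=
      (ContinuousLinearMap.flipₗᵢ ℝ 𝔫 𝔫 ℝ).toContinuousLinearEquiv.contDiff.comp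
        (h2.clm_comp hA)
    exact h3

/-- The subspace `𝔙`, the orthogonal complement of the center of `𝔫`. -/
abbrev centerCompl (𝔫 : Type*) [MetricLieAlgebra 𝔫] : Submodule ℝ 𝔫 :=
  (LieAlgebra.center ℝ 𝔫).toSubmoduleᗮ

/-- The linear map `j(Z) : 𝔙 → 𝔙` with `⟨j(Z)X, Y⟩ = ⟨[X, Y], Z⟩` for `X, Y ∈ 𝔙`, that is,
`j(Z)X = (ad X)^* Z`. -/
def jMap (Z : 𝔫) : centerCompl 𝔫 →ₗ[ℝ] centerCompl 𝔫 where
  toFun X := ⟨LinearMap.adjoint (LieModule.toEnd ℝ 𝔫 𝔫 (X : 𝔫)) Z, by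
    rw [Submodule.mem_orthogonal]
    intro Y hY
    rw [LinearMap.adjoint_inner_right]
    have h : ⁅(X : 𝔫), Y⁆ = 0 := (LieModule.mem_maxTrivSubmodule ℝ 𝔫 𝔫 Y).1 hY X
    rw [LieModule.toEnd_apply_apply, h, inner_zero_left]⟩
  map_add' X Y := by
    apply Subtype.ext
    simp
  map_smul' c X := by
    apply Subtype.ext
    simp

theorem inner_jMap (Z : 𝔫) (X Y : centerCompl 𝔫) :
    inner ℝ (jMap Z X : 𝔫) (Y : 𝔫) = inner ℝ ⁅(X : 𝔫), (Y : 𝔫)⁆ Z := by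
  change inner ℝ (LinearMap.adjoint (LieModule.toEnd ℝ 𝔫 𝔫 (X : 𝔫)) Z) (Y : 𝔫) = _
  rw [LinearMap.adjoint_inner_left, real_inner_comm, LieModule.toEnd_apply_apply]

/-- A basis `{A₁, …, A_r, B₁, …, B_M, j(Z)B₁, …, j(Z)B_M, Z₁, …, Z_s}` of `𝔫` adapted to `Z`,
where `± i lam₁, …, ± i lam_M` are the nonzero eigenvalues of `j(Z)`, with multiplicities. -/
structure AdaptedBasis [IsTwoStepNilpotent 𝔫] (Z : 𝔫) (r M s : ℕ) where
  lam : Fin M → ℝ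
  A : Fin r → centerCompl 𝔫
  B : Fin M → centerCompl 𝔫
  C : Fin s → 𝔫
  lam_pos : ∀ k, 0 < lam k
  /-- the nonzero complex eigenvalues of `j(Z)`, counted with multiplicity -/
  eigenvalues : (((jMap Z).charpoly.map (algebraMap ℝ ℂ)).roots.filter (fun μ => μ ≠ 0)) =
    Finset.univ.val.map (fun k => Complex.I * (lam k : ℂ))
      + Finset.univ.val.map (fun k => -(Complex.I * (lam k : ℂ)))
  linearIndependent : LinearIndependent ℝ
    (Sum.elim (fun i => (A i : 𝔫)) (Sum.elim (fun k => (B k : 𝔫))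
      (Sum.elim (fun k => (jMap Z (B k) : 𝔫)) C)))
  span_eq_top : Submodule.span ℝ (Set.range
    (Sum.elim (fun i => (A i : 𝔫)) (Sum.elim (fun k => (B k : 𝔫))
      (Sum.elim (fun k => (jMap Z (B k) : 𝔫)) C)))) = ⊤
  span_A : Submodule.span ℝ (Set.range A) = LinearMap.ker (jMap Z)
  span_C : Submodule.span ℝ (Set.range C) = (LieAlgebra.center ℝ 𝔫).toSubmodule
  /-- `R_Z(B_k) = (1/4) lam_k² B_k`, where `R_Z(X) = R(X, Z)Z` at the identity `0` of `N` -/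
  curvature_B : ∀ k, (leftInvariantMetric 𝔫).curvature 0 (B k : 𝔫) Z Z =
    ((1 / 4 : ℝ) * lam k ^ 2) • (B k : 𝔫)

namespace AdaptedBasis

variable [IsTwoStepNilpotent 𝔫] {Z : 𝔫} {r M s : ℕ} (𝔅 : AdaptedBasis Z r M s)

/-- `V_k(t) = B_k(γ_Z(t))`. -/
def fieldV (k : Fin M) (t : ℝ) : 𝔫 :=
  leftInvariantField (𝔅.B k : 𝔫) (centralGeodesic Z t)

/-- `W_k(t) = (j(Z)B_k)(γ_Z(t))`. -/
def fieldW (k : Fin M) (t : ℝ) : 𝔫 :=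
  leftInvariantField (jMap Z (𝔅.B k) : 𝔫) (centralGeodesic Z t)

/-- `X_k(t) = cos(lam_k t) B_k(γ_Z(t)) + (1/lam_k) sin(lam_k t) (j(Z)B_k)(γ_Z(t))`. -/
def fieldX (k : Fin M) (t : ℝ) : 𝔫 :=
  Real.cos (𝔅.lam k * t) • 𝔅.fieldV k t
    + ((1 / 𝔅.lam k) * Real.sin (𝔅.lam k * t)) • 𝔅.fieldW k t

/-- `Y_k(t) = sin(lam_k t) B_k(γ_Z(t)) - (1/lam_k) cos(lam_k t) (j(Z)B_k)(γ_Z(t))`. -/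
def fieldY (k : Fin M) (t : ℝ) : 𝔫 :=
  Real.sin (𝔅.lam k * t) • 𝔅.fieldV k t
    - ((1 / 𝔅.lam k) * Real.cos (𝔅.lam k * t)) • 𝔅.fieldW k t

/-- `ξ_k = X_k - V_k`. -/
def xi (k : Fin M) : ℝ → 𝔫 := fun t => 𝔅.fieldX k t - 𝔅.fieldV k t

/-- `η_k = Y_k + (1/lam_k) W_k`. -/
def eta (k : Fin M) : ℝ → 𝔫 := fun t => 𝔅.fieldY k t + (1 / 𝔅.lam k) • 𝔅.fieldW k t

/-- The set `I` of those `k` for which `t₀ = 2πm/lam_k` for some positive integer `m`. -/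
def resonant (t₀ : ℝ) : Set (Fin M) :=
  {k | ∃ m : ℕ, 0 < m ∧ t₀ = 2 * Real.pi * m / 𝔅.lam k}

end AdaptedBasis

end Nilpotent

end CentralConjugate

end

/-! Write `J` for `jExt Z`, the extension of `j(Z)` by zero on the center. Since `Z` is central,
left translation by `exp(tZ)` is plain translation in the exponential chart. So the metric and its
Christoffel symbols do not change in the direction `Z`, and left invariant fields are constant
vectors along the geodesic. The Koszul formula gives `∇Y = Y' - (1/2) J Y` along the geodesic, and
the curvature term is `R(Y, Z)Z = -(1/4) J² Y`. The `J²` terms cancel, and the Jacobi equation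
becomes `Y'' = J Y'`, which has constant coefficients (`isJacobiField_central_iff`).

In an adapted basis `J` kills the `A` and `C` vectors and acts on each plane spanned by `B_k`,
`j(Z)B_k` with square `-lam_k²`. A Jacobi field with `Y 0 = 0` is thus `t • ℓ` with `J ℓ = 0`, plus
a combination of the `ξ_k` and `η_k` (`exists_eq_of_mem_jacobiFields`). Vanishing at `t₀` forces `ℓ
= 0` and gives a 2×2 system for each `k`, singular exactly when `cos(lam_k t₀) = 1`; in that case
both `ξ_k` and `η_k` vanish at `t₀` (`jacobiFieldsVanishing_eq_span`). Solutions come in independent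
pairs, so the dimension is even.

Adapted bases exist because a skew symmetric operator splits orthogonally into its kernel and
invariant planes (`exists_skewNormalForm`). -/

namespace CentralConjugate

open RiemannianMetric

/-! ### Left invariant geometry along a central geodesic -/

section Metric

variable {𝔫 : Type*} [MetricLieAlgebra 𝔫] [FiniteDimensional ℝ 𝔫]

/-- The skew symmetric extension of `j(Z)` to the whole Lie algebra by zero on the center. -/
noncomputable def jExt (Z : 𝔫) : 𝔫 →ₗ[ℝ] 𝔫 where
  toFun X := LinearMap.adjoint (LieModule.toEnd ℝ 𝔫 𝔫 X) Z
  map_add' X Y := by simp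
  map_smul' c X := by simp

theorem inner_jExt (Z X Y : 𝔫) : inner ℝ (jExt Z X) Y = inner ℝ ⁅X, Y⁆ Z := by
  change inner ℝ (LinearMap.adjoint (LieModule.toEnd ℝ 𝔫 𝔫 X) Z) Y = _
  rw [LinearMap.adjoint_inner_left, real_inner_comm, LieModule.toEnd_apply_apply]

theorem jExt_coe (Z : 𝔫) (X : centerCompl 𝔫) : jExt Z (X : 𝔫) = (jMap Z X : 𝔫) := rfl

theorem jExt_eq_zero_of_mem_center (Z : 𝔫) {X : 𝔫} (hX : X ∈ LieAlgebra.center ℝ 𝔫) :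
    jExt Z X = 0 := by
  refine ext_inner_right ℝ fun Y => ?_
  have h : ⁅Y, X⁆ = 0 := (LieModule.mem_maxTrivSubmodule ℝ 𝔫 𝔫 X).1 hX Y
  rw [inner_jExt, ← lie_skew, h]
  simp

variable [IsTwoStepNilpotent 𝔫]

-- Two-step nilpotency puts every bracket in the center. The later lemmas use `Z` only through this
-- centrality.
omit [FiniteDimensional ℝ 𝔫] in
theorem lie_eq_zero_of_mem_commutator {Z : 𝔫}
    (hZ : Z ∈ ⁅(⊤ : LieIdeal ℝ 𝔫), (⊤ : LieIdeal ℝ 𝔫)⁆) (X : 𝔫) : ⁅Z, X⁆ = 0 := by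
  have h : ⁅(⊤ : LieIdeal ℝ 𝔫), (⊤ : LieIdeal ℝ 𝔫)⁆ ≤ LieAlgebra.center ℝ 𝔫 := by
    rw [LieSubmodule.lieIdeal_oper_eq_span, LieSubmodule.lieSpan_le]
    rintro _ ⟨x, y, rfl⟩
    refine (LieModule.mem_maxTrivSubmodule ℝ 𝔫 𝔫 _).2 fun w => ?_
    rw [← lie_skew, IsTwoStepNilpotent.lie_lie, neg_zero]
  rw [← lie_skew, (LieModule.mem_maxTrivSubmodule ℝ 𝔫 𝔫 _).1 (h hZ) X, neg_zero]

theorem leftInvariantMetric_form (p u v : 𝔫) :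
    (leftInvariantMetric 𝔫).form p u v =
      inner ℝ (u - (1 / 2 : ℝ) • ⁅p, u⁆) (v - (1 / 2 : ℝ) • ⁅p, v⁆) := by
  have h : ∀ w : 𝔫, fderiv ℝ (leftTranslation (-p)) p w = w - (1 / 2 : ℝ) • ⁅p, w⁆ := fun w => by
    simp [fderiv_leftTranslation, sub_eq_add_neg]
  simp only [← h]
  rfl

/-- Along the line `p + s • w` both slots of the inner product in `leftInvariantMetric_form` are
affine in `s`, so the product rule in one real variable suffices. -/
theorem fderiv_leftInvariantMetric_form (p w u v : 𝔫) :
    fderiv ℝ (leftInvariantMetric 𝔫).form p w u v =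
      -(1 / 2) * (inner ℝ ⁅w, u⁆ (v - (1 / 2 : ℝ) • ⁅p, v⁆)
        + inner ℝ (u - (1 / 2 : ℝ) • ⁅p, u⁆) ⁅w, v⁆) := by
  have hd : HasFDerivAt (leftInvariantMetric 𝔫).form
      (fderiv ℝ (leftInvariantMetric 𝔫).form p) p :=
    ((leftInvariantMetric 𝔫).smooth.differentiable (by simp) p).hasFDerivAt
  have hline : HasDerivAt (fun s : ℝ => p + s • w) w 0 := by
    simpa using ((hasDerivAt_id (0 : ℝ)).smul_const w).const_add p
  have h1 : HasDerivAt (fun s : ℝ => (leftInvariantMetric 𝔫).form (p + s • w))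
      (fderiv ℝ (leftInvariantMetric 𝔫).form p w) 0 := by
    refine HasFDerivAt.comp_hasDerivAt (0 : ℝ) (f := fun s : ℝ => p + s • w) ?_ hline
    simpa using hd
  have h2 : HasDerivAt (fun s : ℝ => (leftInvariantMetric 𝔫).form (p + s • w) u v)
      (fderiv ℝ (leftInvariantMetric 𝔫).form p w u v) 0 := by
    have := (h1.clm_apply (hasDerivAt_const 0 u)).clm_apply (hasDerivAt_const 0 v)
    simpa using this
  have haff : ∀ x : 𝔫, HasDerivAt (fun s : ℝ => x - (1 / 2 : ℝ) • ⁅p + s • w, x⁆)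
      (-((1 / 2 : ℝ) • ⁅w, x⁆)) 0 := by
    intro x
    have h := (((hasDerivAt_id (0 : ℝ)).smul_const ⁅w, x⁆).const_add ⁅p, x⁆).const_smul
      (1 / 2 : ℝ) |>.const_sub x
    simpa [add_lie, smul_lie] using h
  have h3 := (haff u).inner ℝ (haff v)
  simp only [← leftInvariantMetric_form] at h3
  rw [h2.unique h3]
  simp [inner_smul_left, inner_smul_right]
  ring

theorem form_of_central {p : 𝔫} (hp : ∀ X : 𝔫, ⁅p, X⁆ = 0) (u v : 𝔫) :
    (leftInvariantMetric 𝔫).form p u v = inner ℝ u v := by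
  simp [leftInvariantMetric_form, hp]

variable {Z : 𝔫}

omit [FiniteDimensional ℝ 𝔫] [IsTwoStepNilpotent 𝔫] in
theorem lie_smul_central (hZ : ∀ X : 𝔫, ⁅Z, X⁆ = 0)
    (t : ℝ) (X : 𝔫) : ⁅t • Z, X⁆ = 0 := by rw [smul_lie, hZ, smul_zero]

/-- At a central point the metric is the original inner product. In the Koszul formula the
derivative along `Z` drops out, and the other two terms each contribute half of `-(1/2)⟨[v, w], Z⟩`.
-/
theorem christoffel_central_left (hZ : ∀ X : 𝔫, ⁅Z, X⁆ = 0) (t : ℝ) (v : 𝔫) :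
    (leftInvariantMetric 𝔫).christoffel (t • Z) Z v = -((1 / 2 : ℝ) • jExt Z v) := by
  have hZ' : ∀ X, ⁅X, Z⁆ = 0 := fun X => by rw [← lie_skew, hZ, neg_zero]
  refine ext_inner_right ℝ fun w => ?_
  have h := (leftInvariantMetric 𝔫).form_christoffel (t • Z) Z v w
  rw [form_of_central (lie_smul_central hZ t)] at h
  rw [h]
  simp only [fderiv_leftInvariantMetric_form, lie_smul_central hZ, hZ, hZ', smul_zero, sub_zero,
    inner_zero_left, inner_zero_right, inner_neg_left, inner_smul_left, inner_jExt]
  rw [← lie_skew w v, inner_neg_right, real_inner_comm Z]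
  simp
  ring

theorem christoffel_central_right (hZ : ∀ X : 𝔫, ⁅Z, X⁆ = 0) (t : ℝ) (v : 𝔫) :
    (leftInvariantMetric 𝔫).christoffel (t • Z) v Z = -((1 / 2 : ℝ) • jExt Z v) := by
  rw [← christoffel_central_left hZ t]
  have h : (leftInvariantMetric 𝔫).christoffelFirst (t • Z) v Z
      = (leftInvariantMetric 𝔫).christoffelFirst (t • Z) Z v := by
    ext w
    simp [christoffelFirst, fderiv_leftInvariantMetric_form, lie_smul_central hZ]
    simp only [real_inner_comm]
    ring
  simp only [christoffel, h]

/-- Needed at every point `q`, not only on the geodesic, because `curvature` differentiates this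
function in an arbitrary direction. -/
theorem christoffel_central_self (hZ : ∀ X : 𝔫, ⁅Z, X⁆ = 0)
    (q : 𝔫) : (leftInvariantMetric 𝔫).christoffel q Z Z = 0 := by
  have hZ' : ∀ X, ⁅X, Z⁆ = 0 := fun X => by rw [← lie_skew, hZ, neg_zero]
  have h : (leftInvariantMetric 𝔫).christoffelFirst q Z Z = 0 := by
    ext w
    simp [christoffelFirst, fderiv_leftInvariantMetric_form, hZ, hZ']
  simp [christoffel, h]

/-- The base point enters the metric and its derivative only through brackets, which do not see a
central summand. -/
theorem christoffel_add_central (hZ : ∀ X : 𝔫, ⁅Z, X⁆ = 0) (q u v : 𝔫) (s : ℝ) :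
    (leftInvariantMetric 𝔫).christoffel (q + s • Z) u v =
      (leftInvariantMetric 𝔫).christoffel q u v := by
  have hf : (leftInvariantMetric 𝔫).form (q + s • Z) = (leftInvariantMetric 𝔫).form q := by
    ext a b
    simp [leftInvariantMetric_form, hZ]
  have h : (leftInvariantMetric 𝔫).christoffelFirst (q + s • Z) u v
      = (leftInvariantMetric 𝔫).christoffelFirst q u v := by
    ext w
    simp [christoffelFirst, fderiv_leftInvariantMetric_form, hZ]
  simp only [christoffel, h, hf]

theorem fderiv_christoffel_central (hZ : ∀ X : 𝔫, ⁅Z, X⁆ = 0) (q u v : 𝔫) :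
    fderiv ℝ (fun p => (leftInvariantMetric 𝔫).christoffel p u v) q Z = 0 := by
  have hline : HasDerivAt (fun s : ℝ => q + s • Z) Z 0 := by
    simpa using ((hasDerivAt_id (0 : ℝ)).smul_const Z).const_add q
  have h1 : HasDerivAt (fun s : ℝ => (leftInvariantMetric 𝔫).christoffel (q + s • Z) u v)
      (fderiv ℝ (fun p => (leftInvariantMetric 𝔫).christoffel p u v) q Z) 0 := by
    refine HasFDerivAt.comp_hasDerivAt (0 : ℝ) (f := fun s : ℝ => q + s • Z)
      (l := fun p => (leftInvariantMetric 𝔫).christoffel p u v) ?_ hline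
    simpa using ((leftInvariantMetric 𝔫).differentiableAt_christoffel q u v).hasFDerivAt
  simp only [christoffel_add_central hZ] at h1
  exact h1.unique (hasDerivAt_const _ _)

/-- `R(X, Z)Z = -(1/4) j(Z)² X` along the central geodesic. -/
theorem curvature_central (hZ : ∀ X : 𝔫, ⁅Z, X⁆ = 0) (t : ℝ) (u : 𝔫) :
    (leftInvariantMetric 𝔫).curvature (t • Z) u Z Z = -((1 / 4 : ℝ) • jExt Z (jExt Z u)) := by
  simp only [curvature, christoffel_central_self hZ, fderiv_christoffel_central hZ,
    christoffel_central_right hZ, christoffel_central_left hZ]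
  have h0 : (leftInvariantMetric 𝔫).christoffel (t • Z) u 0 = 0 := by
    simpa using (leftInvariantMetric 𝔫).christoffel_smul_right (t • Z) u 0 0
  rw [h0]
  simp [smul_smul]
  norm_num

theorem curvature_central_zero (hZ : ∀ X : 𝔫, ⁅Z, X⁆ = 0) (u : 𝔫) :
    (leftInvariantMetric 𝔫).curvature 0 u Z Z = -((1 / 4 : ℝ) • jExt Z (jExt Z u)) := by
  simpa using curvature_central hZ 0 u

-- The differential of left translation by `t • Z` is `id + (1/2) ad(t • Z)`, which is the identity.
omit [IsTwoStepNilpotent 𝔫] in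
theorem leftInvariantField_centralGeodesic (hZ : ∀ X : 𝔫, ⁅Z, X⁆ = 0) (X : 𝔫) (t : ℝ) :
    leftInvariantField X (centralGeodesic Z t) = X := by
  simp [leftInvariantField, fderiv_leftTranslation, centralGeodesic, hZ]

omit [IsTwoStepNilpotent 𝔫] in
theorem deriv_jExt {Y : ℝ → 𝔫} (hY : Differentiable ℝ Y) (t : ℝ) :
    deriv (fun s => jExt Z (Y s)) t = jExt Z (deriv Y t) :=
  ((LinearMap.toContinuousLinearMap (jExt Z)).hasFDerivAt.comp_hasDerivAt t
    (hY t).hasDerivAt).deriv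

/-- The Jacobi equation along the central geodesic is `Y'' = j(Z) Y'`. -/
theorem isJacobiField_central_iff (hZ : ∀ X : 𝔫, ⁅Z, X⁆ = 0)
    (Y : ℝ → 𝔫) :
    (leftInvariantMetric 𝔫).IsJacobiField (centralGeodesic Z) Y ↔
      ContDiff ℝ ∞ Y ∧ ∀ t, deriv (deriv Y) t = jExt Z (deriv Y t) := by
  refine and_congr_right fun hY => forall_congr' fun t => ?_
  have hγ : deriv (centralGeodesic Z) = fun _ => Z :=
    funext fun t => (hasDerivAt_centralGeodesic Z t).deriv
  have hc : ∀ X : ℝ → 𝔫, (leftInvariantMetric 𝔫).covDeriv (centralGeodesic Z) X =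
      fun t => deriv X t - (1 / 2 : ℝ) • jExt Z (X t) := by
    intro X
    funext t
    simp only [covDeriv, hγ, centralGeodesic, christoffel_central_left hZ, sub_eq_add_neg]
  have hdY : Differentiable ℝ Y := hY.differentiable (by simp)
  have hdY' : Differentiable ℝ (deriv Y) :=
    (contDiff_infty_iff_deriv.1 hY).2.differentiable (by simp)
  have hdJ : Differentiable ℝ (fun s => jExt Z (Y s)) :=
    (LinearMap.toContinuousLinearMap (jExt Z)).differentiable.comp hdY
  have h2 : deriv (fun t => deriv Y t - (1 / 2 : ℝ) • jExt Z (Y t)) t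
      = deriv (deriv Y) t - (1 / 2 : ℝ) • jExt Z (deriv Y t) := by
    rw [deriv_fun_sub (hdY' t) ((hdJ t).fun_const_smul _), deriv_fun_const_smul _ (hdJ t),
      deriv_jExt hdY]
  rw [hc, hc]
  simp only [hγ]
  rw [h2, centralGeodesic, curvature_central hZ, ← sub_eq_zero (a := deriv (deriv Y) t)]
  simp only [map_sub, map_smul]
  -- The second covariant derivative contributes `+(1/4) J² Y`, which the curvature term cancels;
  -- its two first-order halves add up to `-J Y'`.
  have : deriv (deriv Y) t - (1 / 2 : ℝ) • jExt Z (deriv Y t)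
      - (1 / 2 : ℝ) • (jExt Z (deriv Y t) - (1 / 2 : ℝ) • jExt Z (jExt Z (Y t)))
      + -((1 / 4 : ℝ) • jExt Z (jExt Z (Y t))) = deriv (deriv Y) t - jExt Z (deriv Y t) := by
    module
  rw [this]

end Metric

/-! ### Normal form of a skew symmetric operator -/

open Polynomial

section SkewNormalForm

universe u

/-- A basis in which a skew symmetric operator `T` is in normal form: `T` vanishes on the part
indexed by `ι`, and the remaining vectors come in pairs `B k, T (B k)` with
`T (T (B k)) = -lam k ^ 2 • B k`. -/
structure SkewNormalForm {E : Type u} [AddCommGroup E] [Module ℝ E] [Module.Finite ℝ E]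
    (T : E →ₗ[ℝ] E) (ι κ : Type) [Fintype ι] [Fintype κ] where
  lam : κ → ℝ
  lam_pos : ∀ k, 0 < lam k
  basis : Module.Basis (ι ⊕ κ ⊕ κ) ℝ E
  map_kernel : ∀ i, T (basis (.inl i)) = 0
  map_fst : ∀ k, T (basis (.inr (.inl k))) = basis (.inr (.inr k))
  map_snd : ∀ k, T (basis (.inr (.inr k))) = -(lam k ^ 2) • basis (.inr (.inl k))
  charpoly_eq : T.charpoly = X ^ Fintype.card ι * ∏ k, (X ^ 2 + C (lam k ^ 2))

/-- Moving a pair into the two copies of `Option κ`. -/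
def pairEquiv (ι κ : Type) : Fin 2 ⊕ (ι ⊕ κ ⊕ κ) ≃ ι ⊕ Option κ ⊕ Option κ where
  toFun
    | .inl 0 => .inr (.inl none)
    | .inl 1 => .inr (.inr none)
    | .inr (.inl i) => .inl i
    | .inr (.inr (.inl k)) => .inr (.inl (some k))
    | .inr (.inr (.inr k)) => .inr (.inr (some k))
  invFun
    | .inl i => .inr (.inl i)
    | .inr (.inl none) => .inl 0
    | .inr (.inr none) => .inl 1
    | .inr (.inl (some k)) => .inr (.inr (.inl k))
    | .inr (.inr (some k)) => .inr (.inr (.inr k))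
  left_inv := by
    rintro (i | i | i | i)
    · fin_cases i <;> rfl
    all_goals rfl
  right_inv := by
    rintro (i | (_ | i) | (_ | i)) <;> rfl

variable {E : Type u} [NormedAddCommGroup E] [InnerProductSpace ℝ E] [FiniteDimensional ℝ E]

/-- `T²` is symmetric with `⟨T² x, x⟩ = -‖T x‖²`, so a unit eigenvector has eigenvalue `-‖T x‖²`,
whence `l = ‖T x‖`. If all eigenvalues were zero, `T²` and then `T` would vanish. -/
theorem exists_eigenvector_sq_of_skew {T : E →ₗ[ℝ] E}
    (hT : ∀ x y, inner ℝ (T x) y = -inner ℝ x (T y)) (h0 : T ≠ 0) :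
    ∃ (x : E) (l : ℝ), x ≠ 0 ∧ 0 < l ∧ T (T x) = -(l ^ 2) • x := by
  have hS : (T ∘ₗ T).IsSymmetric := fun x y => by
    simp [hT]
  have hinner : ∀ x, inner ℝ (T (T x)) x = -‖T x‖ ^ 2 := fun x => by
    rw [hT, real_inner_self_eq_norm_sq]
  obtain ⟨i, hi⟩ : ∃ i, hS.eigenvalues rfl i ≠ 0 := by
    by_contra! h
    apply h0
    have hTT : T ∘ₗ T = 0 := (hS.eigenvectorBasis rfl).toBasis.ext fun i => by
      rw [OrthonormalBasis.coe_toBasis, hS.apply_eigenvectorBasis, h i]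
      simp
    ext x
    have h1 := hinner x
    rw [show T (T x) = 0 from LinearMap.congr_fun hTT x, inner_zero_left] at h1
    simpa using h1
  set x := hS.eigenvectorBasis rfl i with hx
  set μ := hS.eigenvalues rfl i
  have hxx : T (T x) = μ • x := hS.apply_eigenvectorBasis rfl i
  have hn : ‖x‖ = 1 := (hS.eigenvectorBasis rfl).orthonormal.1 i
  have hμ : μ = -‖T x‖ ^ 2 := by
    rw [← hinner x, hxx, inner_smul_left, real_inner_self_eq_norm_sq, hn]
    simp
  refine ⟨x, ‖T x‖, ?_, ?_, ?_⟩
  · rw [← norm_ne_zero_iff, hn]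
    exact one_ne_zero
  · refine lt_of_le_of_ne (norm_nonneg _) fun h => hi ?_
    rw [hμ, ← h]
    simp
  · rw [hxx, hμ]

-- Skewness makes `T x` orthogonal to `x`, and `T x ≠ 0` because `T (T x) ≠ 0`; nonzero orthogonal
-- vectors are independent.
omit [FiniteDimensional ℝ E] in
theorem linearIndependent_pair_of_skew {T : E →ₗ[ℝ] E}
    (hT : ∀ x y, inner ℝ (T x) y = -inner ℝ x (T y)) {x : E} {l : ℝ} (hx : x ≠ 0) (hl : 0 < l)
    (hTT : T (T x) = -(l ^ 2) • x) : LinearIndependent ℝ ![x, T x] := by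
  have hxT : inner ℝ x (T x) = 0 := by
    have := hT x x
    rw [real_inner_comm] at this
    linarith
  have hTx : T x ≠ 0 := fun h => by
    rw [h, map_zero, eq_comm, smul_eq_zero] at hTT
    simp [hx, hl.ne'] at hTT
  rw [LinearIndependent.pair_iff]
  intro a b h
  have h1 : inner ℝ x (a • x + b • T x) = 0 := by rw [h, inner_zero_right]
  have h2 : inner ℝ (T x) (a • x + b • T x) = 0 := by rw [h, inner_zero_right]
  simp only [inner_add_right, inner_smul_right, hxT, real_inner_comm x (T x)] at h1 h2
  simp [hx, hTx] at h1 h2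
  exact ⟨h1, h2⟩

/-- Strong induction on the dimension: the plane `W` spanned by `x` and `T x` is invariant, skewness
makes `Wᗮ` invariant, and the induction hypothesis applies there. Arbitrary finite index types let
the step pass from `κ` to `Option κ`. -/
theorem exists_skewNormalForm (n : ℕ) : ∀ (E : Type u) [NormedAddCommGroup E]
    [InnerProductSpace ℝ E] [FiniteDimensional ℝ E] (T : E →ₗ[ℝ] E),
    (∀ x y, inner ℝ (T x) y = -inner ℝ x (T y)) → Module.finrank ℝ E = n →
    ∃ (ι κ : Type) (_ : Fintype ι) (_ : Fintype κ), Nonempty (SkewNormalForm T ι κ) := by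
  induction n using Nat.strong_induction_on with
  | _ n ih =>
  intro E _ _ _ T hT hn
  by_cases h0 : T = 0
  · refine ⟨Fin (Module.finrank ℝ E), Empty, inferInstance, inferInstance, ⟨?_⟩⟩
    exact
      { lam := Empty.elim
        lam_pos := fun k => k.elim
        basis := (Module.finBasis ℝ E).reindex (Equiv.sumEmpty _ (Empty ⊕ Empty)).symm
        map_kernel := fun i => by simp [h0]
        map_fst := fun k => k.elim
        map_snd := fun k => k.elim
        charpoly_eq := by simp [h0, LinearMap.charpoly_zero] }
  obtain ⟨x, l, hx, hl, hTT⟩ := exists_eigenvector_sq_of_skew hT h0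
  have hli := linearIndependent_pair_of_skew hT hx hl hTT
  set W := Submodule.span ℝ (Set.range ![x, T x]) with hW
  have hxW : x ∈ W := Submodule.subset_span ⟨0, rfl⟩
  have hTxW : T x ∈ W := Submodule.subset_span ⟨1, rfl⟩
  have hinv : ∀ w ∈ W, T w ∈ W := by
    intro w hw
    induction hw using Submodule.span_induction with
    | mem w hw =>
      obtain ⟨i, rfl⟩ := hw
      fin_cases i
      · exact hTxW
      · change T (T x) ∈ W
        rw [hTT]
        exact W.smul_mem _ hxW
    | zero => simp
    | add a b _ _ ha hb => rw [map_add]; exact W.add_mem ha hb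
    | smul c a _ ha => rw [map_smul]; exact W.smul_mem c ha
  have hinv' : ∀ w ∈ Wᗮ, T w ∈ Wᗮ := by
    intro w hw v hv
    rw [← neg_eq_zero, ← hT]
    exact hw _ (hinv v hv)
  have hlt : Module.finrank ℝ Wᗮ < n := by
    have h1 := W.finrank_add_finrank_orthogonal
    have h2 : Module.finrank ℝ W = 2 := by
      rw [hW, finrank_span_eq_card hli, Fintype.card_fin]
    omega
  obtain ⟨ι, κ, _, _, ⟨S⟩⟩ := ih _ hlt Wᗮ (T.restrict hinv') (fun a b => hT a b) rfl
  let e := W.prodEquivOfIsCompl Wᗮ W.isCompl_orthogonal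
  let bW : Module.Basis (Fin 2) ℝ W := Module.Basis.span hli
  have hb0 : (bW 0 : E) = x := congrArg Subtype.val (Module.Basis.span_apply hli 0)
  have hb1 : (bW 1 : E) = T x := congrArg Subtype.val (Module.Basis.span_apply hli 1)
  -- `T` is conjugate to the block sum of its two restrictions, so characteristic polynomials
  -- multiply.
  have hconj : e.conj ((T.restrict hinv).prodMap (T.restrict hinv')) = T := by
    ext y
    obtain ⟨y, rfl⟩ := e.surjective y
    simp [e, LinearEquiv.conj_apply]
  have hchar : (T.restrict hinv).charpoly = X ^ 2 + C (l ^ 2) := by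
    have hm : LinearMap.toMatrix bW bW (T.restrict hinv) = !![0, -(l ^ 2); 1, 0] := by
      have h0 : (T.restrict hinv) (bW 0) = bW 1 := Subtype.ext (by simp [hb0, hb1])
      have h1 : (T.restrict hinv) (bW 1) = -(l ^ 2) • bW 0 :=
        Subtype.ext (by simp [hb0, hb1, hTT])
      ext i j
      rw [LinearMap.toMatrix_apply]
      fin_cases j
      · simp only [Fin.zero_eta, h0]
        fin_cases i <;> simp
      · simp only [Fin.mk_one, h1]
        fin_cases i <;> simp
    rw [← LinearMap.charpoly_toMatrix _ bW, hm, Matrix.charpoly_fin_two]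
    simp [Matrix.trace_fin_two, Matrix.det_fin_two]
  let b := ((bW.prod S.basis).map e).reindex (pairEquiv ι κ)
  have hbi : ∀ i, b (.inl i) = (S.basis (.inl i) : E) := fun i => by
    simp [b, pairEquiv, e]
  have hb10 : b (.inr (.inl none)) = x := by
    simp [b, pairEquiv, e, hb0]
  have hb20 : b (.inr (.inr none)) = T x := by
    simp [b, pairEquiv, e, hb1]
  have hb1k : ∀ k, b (.inr (.inl (some k))) = (S.basis (.inr (.inl k)) : E) := fun k => by
    simp [b, pairEquiv, e]
  have hb2k : ∀ k, b (.inr (.inr (some k))) = (S.basis (.inr (.inr k)) : E) := fun k => by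
    simp [b, pairEquiv, e]
  refine ⟨ι, Option κ, inferInstance, inferInstance, ⟨?_⟩⟩
  exact
    { lam := fun k => k.elim l S.lam
      lam_pos := by
        rintro (_ | k)
        exacts [hl, S.lam_pos k]
      basis := b
      map_kernel := fun i => by
        rw [hbi]
        exact congrArg Subtype.val (S.map_kernel i)
      map_fst := by
        rintro (_ | k)
        · rw [hb10, hb20]
        · rw [hb1k, hb2k]
          exact congrArg Subtype.val (S.map_fst k)
      map_snd := by
        rintro (_ | k)
        · rw [hb10, hb20]
          exact hTT
        · rw [hb1k, hb2k]
          exact congrArg Subtype.val (S.map_snd k)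
      charpoly_eq := by
        have hprod : T.charpoly = (T.restrict hinv).charpoly * (T.restrict hinv').charpoly := by
          rw [← LinearMap.charpoly_prodMap, ← LinearEquiv.charpoly_conj e, hconj]
        rw [hprod, hchar, S.charpoly_eq, Fintype.prod_option]
        simp only [Option.elim]
        ring }

end SkewNormalForm

/-! ### Kernel and complex eigenvalues read off from a normal form -/

section NormalFormProperties

variable {E : Type*} [AddCommGroup E] [Module ℝ E] [Module.Finite ℝ E] {T : E →ₗ[ℝ] E}
  {ι κ : Type} [Fintype ι] [Fintype κ] (S : SkewNormalForm T ι κ)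

/-- On the paired vectors `T` swaps coordinates up to the nonzero factors `1` and `-lam k ^ 2`, so a
kernel element has no paired coordinates. -/
theorem SkewNormalForm.span_kernel :
    Submodule.span ℝ (Set.range fun i => S.basis (.inl i)) = LinearMap.ker T := by
  apply le_antisymm
  · rw [Submodule.span_le]
    rintro _ ⟨i, rfl⟩
    exact S.map_kernel i
  intro x hx
  have hsum := S.basis.sum_repr x
  simp only [Fintype.sum_sum_type] at hsum
  set c := S.basis.repr x
  have hTx : ∑ k, c (.inr (.inl k)) • S.basis (.inr (.inr k))
      + ∑ k, (-(S.lam k ^ 2) * c (.inr (.inr k))) • S.basis (.inr (.inl k)) = 0 := by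
    have h : T x = 0 := hx
    rw [← hsum] at h
    simpa [S.map_kernel, S.map_fst, S.map_snd, smul_smul, mul_comm] using h
  have hli := Fintype.linearIndependent_iff.1 S.basis.linearIndependent
    (Sum.elim 0 (Sum.elim (fun k => -(S.lam k ^ 2) * c (.inr (.inr k)))
      (fun k => c (.inr (.inl k))))) (by
        simp only [Fintype.sum_sum_type, Sum.elim_inl, Sum.elim_inr, Pi.zero_apply, zero_smul,
          Finset.sum_const_zero, zero_add]
        rw [add_comm]
        exact hTx)
  have h1 : ∀ k, c (.inr (.inl k)) = 0 := fun k => hli (.inr (.inr k))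
  have h2 : ∀ k, c (.inr (.inr k)) = 0 := fun k => by
    have := hli (.inr (.inl k))
    simpa [(S.lam_pos k).ne'] using this
  rw [← hsum]
  simp only [h1, h2, zero_smul, Finset.sum_const_zero, add_zero]
  exact Submodule.sum_mem _ fun i _ => Submodule.smul_mem _ _ (Submodule.subset_span ⟨i, rfl⟩)

/-- Over `ℂ` each factor `X² + lam²` splits as `(X - i lam)(X + i lam)`. Writing the polynomial as a
product over a multiset of roots keeps multiplicities; the filter then removes the zeros coming from
the kernel. -/
theorem SkewNormalForm.roots_charpoly :
    (T.charpoly.map (algebraMap ℝ ℂ)).roots.filter (fun μ => μ ≠ 0) =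
      Finset.univ.val.map (fun k => Complex.I * (S.lam k : ℂ))
        + Finset.univ.val.map (fun k => -(Complex.I * (S.lam k : ℂ))) := by
  have hfac : T.charpoly.map (algebraMap ℝ ℂ) =
      ((Multiset.replicate (Fintype.card ι) (0 : ℂ)
        + (Finset.univ.val.map (fun k => Complex.I * (S.lam k : ℂ))
        + Finset.univ.val.map (fun k => -(Complex.I * (S.lam k : ℂ))))).map
          (fun a => X - C a)).prod := by
    rw [S.charpoly_eq]
    simp only [Multiset.map_add, Multiset.prod_add, Multiset.map_replicate,
      Multiset.prod_replicate, Multiset.map_map, Polynomial.map_mul, Polynomial.map_pow,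
      Polynomial.map_X, Polynomial.map_prod, Polynomial.map_add, Polynomial.map_C, map_zero,
      sub_zero, Function.comp_def]
    congr 1
    change _ = (∏ k, (X - C (Complex.I * (S.lam k : ℂ)))) *
      ∏ k, (X - C (-(Complex.I * (S.lam k : ℂ))))
    rw [← Finset.prod_mul_distrib]
    refine Finset.prod_congr rfl fun k _ => ?_
    have : (algebraMap ℝ ℂ) (S.lam k ^ 2) = -((Complex.I * (S.lam k : ℂ)) ^ 2) := by
      simp [mul_pow]
    rw [this]
    simp only [map_neg, map_pow]
    ring
  rw [hfac, roots_multiset_prod_X_sub_C, Multiset.filter_add]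
  have h0 : Multiset.filter (fun μ : ℂ => μ ≠ 0) (Multiset.replicate (Fintype.card ι) 0) = 0 := by
    rw [Multiset.filter_eq_nil]
    intro a ha
    simp [Multiset.eq_of_mem_replicate ha]
  rw [h0, zero_add, Multiset.filter_eq_self]
  intro a ha
  rw [Multiset.mem_add, Multiset.mem_map, Multiset.mem_map] at ha
  obtain ⟨k, -, rfl⟩ | ⟨k, -, rfl⟩ := ha <;> simp [(S.lam_pos k).ne']

end NormalFormProperties

/-! ### Existence of an adapted basis -/

section Existence

variable {𝔫 : Type*} [MetricLieAlgebra 𝔫] [FiniteDimensional ℝ 𝔫]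

theorem jMap_skew (Z : 𝔫) (X Y : centerCompl 𝔫) :
    inner ℝ (jMap Z X) Y = -inner ℝ X (jMap Z Y) := by
  rw [real_inner_comm (jMap Z Y) X, Submodule.coe_inner, Submodule.coe_inner, inner_jMap,
    inner_jMap, ← lie_skew, inner_neg_left]

variable [IsTwoStepNilpotent 𝔫]

/-- A normal form of `j(Z)` on `𝔙` is joined to any basis of the center. The curvature condition is
`j(Z)² B = -lam² B` multiplied by `-1/4`. -/
theorem exists_adaptedBasis {Z : 𝔫} (hZ : ∀ X : 𝔫, ⁅Z, X⁆ = 0) :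
    ∃ r M s : ℕ, Nonempty (AdaptedBasis Z r M s) := by
  obtain ⟨ι, κ, _, _, ⟨S⟩⟩ := exists_skewNormalForm _ (centerCompl 𝔫) (jMap Z) (jMap_skew Z) rfl
  let 𝔷 := (LieAlgebra.center ℝ 𝔫).toSubmodule
  let bC := Module.finBasis ℝ 𝔷
  let eι := Fintype.equivFin ι
  let eκ := Fintype.equivFin κ
  -- The reindexing numbers `ι` and `κ` by `Fin` and reassociates the sums into the order `A`, `B`,
  -- `j(Z)B`, `C`.
  let b := ((S.basis.prod bC).map (𝔷ᗮ.prodEquivOfIsCompl 𝔷 𝔷.isCompl_orthogonal.symm)).reindex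
    ((((eι.sumCongr (eκ.sumCongr eκ)).sumCongr (Equiv.refl _)).trans
      (Equiv.sumAssoc _ _ _)).trans ((Equiv.refl _).sumCongr (Equiv.sumAssoc _ _ _)))
  have hb : (b : _ → 𝔫) = Sum.elim (fun i => (S.basis (.inl (eι.symm i)) : 𝔫))
      (Sum.elim (fun k => (S.basis (.inr (.inl (eκ.symm k))) : 𝔫))
        (Sum.elim (fun k => (jMap Z (S.basis (.inr (.inl (eκ.symm k)))) : 𝔫))
          (fun i => (bC i : 𝔫)))) := by
    funext i
    rcases i with i | i | i | i
    · simp [b]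
    · simp [b]
    · simp [b, S.map_fst]
    · simp [b]
  refine ⟨Fintype.card ι, Fintype.card κ, Module.finrank ℝ 𝔷, ⟨?_⟩⟩
  exact
    { lam := fun k => S.lam (eκ.symm k)
      A := fun i => S.basis (.inl (eι.symm i))
      B := fun k => S.basis (.inr (.inl (eκ.symm k)))
      C := fun i => bC i
      lam_pos := fun k => S.lam_pos _
      eigenvalues := by
        rw [S.roots_charpoly]
        have h : ∀ f : κ → ℂ, Finset.univ.val.map f
            = Finset.univ.val.map (fun k => f (eκ.symm k)) := fun f => by
          rw [← Finset.map_univ_equiv eκ.symm, Finset.map_val, Multiset.map_map]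
          rfl
        rw [h, h (fun k => -(Complex.I * (S.lam k : ℂ)))]
      linearIndependent := hb ▸ b.linearIndependent
      span_eq_top := hb ▸ b.span_eq
      span_A := by
        rw [← S.span_kernel]
        exact congrArg _ (eι.symm.surjective.range_comp fun i => S.basis (.inl i))
      span_C := by
        have h := congrArg (Submodule.map 𝔷.subtype) bC.span_eq
        rw [Submodule.map_span, ← Set.range_comp, Submodule.map_subtype_top] at h
        exact h
      curvature_B := fun k => by
        rw [curvature_central_zero hZ, jExt_coe, jExt_coe, S.map_fst, S.map_snd]
        push_cast
        module }

end Existence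

/-! ### Jacobi fields in an adapted basis -/

section Adapted

variable {𝔫 : Type*} [MetricLieAlgebra 𝔫] [FiniteDimensional ℝ 𝔫] [IsTwoStepNilpotent 𝔫]
  {Z : 𝔫} {r M s : ℕ}

theorem mem_jacobiFields_central_iff (hZ : ∀ X : 𝔫, ⁅Z, X⁆ = 0) (Y : ℝ → 𝔫) :
    Y ∈ (leftInvariantMetric 𝔫).jacobiFields (centralGeodesic Z) (contDiff_centralGeodesic Z) ↔
      ContDiff ℝ ∞ Y ∧ ∀ t, deriv (deriv Y) t = jExt Z (deriv Y t) :=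
  isJacobiField_central_iff hZ Y

/-- The equation is first order and linear in `deriv Y`, so uniqueness gives `deriv Y = 0`, and `Y`
is constant. -/
theorem eq_zero_of_mem_jacobiFields_central (hZ : ∀ X : 𝔫, ⁅Z, X⁆ = 0) {Y : ℝ → 𝔫}
    (hY : Y ∈ (leftInvariantMetric 𝔫).jacobiFields (centralGeodesic Z)
      (contDiff_centralGeodesic Z)) (h0 : Y 0 = 0) (h1 : deriv Y 0 = 0) : Y = 0 := by
  obtain ⟨hc, hode⟩ := (mem_jacobiFields_central_iff hZ Y).1 hY
  have hd : Differentiable ℝ (deriv Y) :=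
    (contDiff_infty_iff_deriv.1 hc).2.differentiable (by simp)
  have hlip : LipschitzWith _ (jExt Z) := (LinearMap.toContinuousLinearMap (jExt Z)).lipschitz
  have hder : deriv Y = fun _ => 0 :=
    ODE_solution_unique_univ (v := fun _ x => jExt Z x) (s := fun _ => Set.univ) (t₀ := 0)
      (fun _ => hlip.lipschitzOnWith)
      (fun t => ⟨by simpa [hode t] using (hd t).hasDerivAt, trivial⟩)
      (fun t => ⟨by simpa using hasDerivAt_const t (0 : 𝔫), trivial⟩) h1
  funext t
  rw [is_const_of_deriv_eq_zero (hc.differentiable (by simp)) (fun t => congrFun hder t) t 0, h0,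
    Pi.zero_apply]

theorem smul_mem_jacobiFields_central (hZ : ∀ X : 𝔫, ⁅Z, X⁆ = 0) {x : 𝔫} (hx : jExt Z x = 0) :
    (fun t : ℝ => t • x) ∈ (leftInvariantMetric 𝔫).jacobiFields (centralGeodesic Z)
      (contDiff_centralGeodesic Z) := by
  have hder : deriv (fun t : ℝ => t • x) = fun _ => x := funext fun t => by
    simpa using ((hasDerivAt_id t).smul_const x).deriv
  refine (mem_jacobiFields_central_iff hZ _).2 ⟨contDiff_id.smul contDiff_const, fun t => ?_⟩
  rw [hder, hx]
  simp

namespace AdaptedBasis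

variable (𝔅 : AdaptedBasis Z r M s)

theorem jExt_A (i : Fin r) : jExt Z (𝔅.A i : 𝔫) = 0 := by
  have h : 𝔅.A i ∈ LinearMap.ker (jMap Z) := by
    rw [← 𝔅.span_A]
    exact Submodule.subset_span ⟨i, rfl⟩
  rw [jExt_coe, LinearMap.mem_ker.1 h]
  rfl

theorem jExt_C (i : Fin s) : jExt Z (𝔅.C i) = 0 := by
  refine jExt_eq_zero_of_mem_center Z ?_
  have h : 𝔅.C i ∈ (LieAlgebra.center ℝ 𝔫).toSubmodule := by
    rw [← 𝔅.span_C]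
    exact Submodule.subset_span ⟨i, rfl⟩
  exact h

/-- The curvature condition on `B` reads `-(1/4) J² B = (1/4) lam² B`; multiplication by `-4`
recovers the action of `J²`. -/
theorem jExt_jMap_B (hZ : ∀ X : 𝔫, ⁅Z, X⁆ = 0) (k : Fin M) :
    jExt Z (jMap Z (𝔅.B k) : 𝔫) = -(𝔅.lam k ^ 2) • (𝔅.B k : 𝔫) := by
  have h := 𝔅.curvature_B k
  rw [curvature_central_zero hZ, jExt_coe] at h
  have h4 := congrArg (fun x => (-4 : ℝ) • x) h
  simp only [smul_neg, smul_smul] at h4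
  rw [neg_smul, ← one_smul ℝ (jExt Z _)]
  calc (1 : ℝ) • jExt Z (jMap Z (𝔅.B k) : 𝔫)
      = -((-4 * (1 / 4) : ℝ) • jExt Z (jMap Z (𝔅.B k) : 𝔫)) := by module
    _ = _ := by rw [h4]; module

theorem xi_apply (hZ : ∀ X : 𝔫, ⁅Z, X⁆ = 0) (k : Fin M) (t : ℝ) :
    𝔅.xi k t = (Real.cos (𝔅.lam k * t) - 1) • (𝔅.B k : 𝔫)
      + (1 / 𝔅.lam k * Real.sin (𝔅.lam k * t)) • (jMap Z (𝔅.B k) : 𝔫) := by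
  simp only [xi, fieldX, fieldV, fieldW, leftInvariantField_centralGeodesic hZ]
  module

theorem eta_apply (hZ : ∀ X : 𝔫, ⁅Z, X⁆ = 0) (k : Fin M) (t : ℝ) :
    𝔅.eta k t = Real.sin (𝔅.lam k * t) • (𝔅.B k : 𝔫)
      + (1 / 𝔅.lam k * (1 - Real.cos (𝔅.lam k * t))) • (jMap Z (𝔅.B k) : 𝔫) := by
  simp only [eta, fieldY, fieldV, fieldW, leftInvariantField_centralGeodesic hZ]
  module

theorem xi_zero (hZ : ∀ X : 𝔫, ⁅Z, X⁆ = 0) (k : Fin M) : 𝔅.xi k 0 = 0 := by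
  simp [xi_apply _ hZ]

theorem eta_zero (hZ : ∀ X : 𝔫, ⁅Z, X⁆ = 0) (k : Fin M) : 𝔅.eta k 0 = 0 := by
  simp [eta_apply _ hZ]

theorem hasDerivAt_cos_lam (k : Fin M) (t : ℝ) :
    HasDerivAt (fun t => Real.cos (𝔅.lam k * t)) (-𝔅.lam k * Real.sin (𝔅.lam k * t)) t := by
  have := (hasDerivAt_const_mul (𝔅.lam k) (x := t)).cos
  convert this using 1
  ring

theorem hasDerivAt_sin_lam (k : Fin M) (t : ℝ) :
    HasDerivAt (fun t => Real.sin (𝔅.lam k * t)) (𝔅.lam k * Real.cos (𝔅.lam k * t)) t := by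
  have := (hasDerivAt_const_mul (𝔅.lam k) (x := t)).sin
  convert this using 1
  ring

theorem hasDerivAt_xi (hZ : ∀ X : 𝔫, ⁅Z, X⁆ = 0) (k : Fin M) (t : ℝ) :
    HasDerivAt (𝔅.xi k) ((-𝔅.lam k * Real.sin (𝔅.lam k * t)) • (𝔅.B k : 𝔫)
      + Real.cos (𝔅.lam k * t) • (jMap Z (𝔅.B k) : 𝔫)) t := by
  rw [funext (𝔅.xi_apply hZ k)]
  have h := (((𝔅.hasDerivAt_cos_lam k t).sub_const 1).smul_const (𝔅.B k : 𝔫)).add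
    (((𝔅.hasDerivAt_sin_lam k t).const_mul (1 / 𝔅.lam k)).smul_const (jMap Z (𝔅.B k) : 𝔫))
  rw [← mul_assoc, one_div_mul_cancel (𝔅.lam_pos k).ne', one_mul] at h
  exact h

theorem hasDerivAt_eta (hZ : ∀ X : 𝔫, ⁅Z, X⁆ = 0) (k : Fin M) (t : ℝ) :
    HasDerivAt (𝔅.eta k) ((𝔅.lam k * Real.cos (𝔅.lam k * t)) • (𝔅.B k : 𝔫)
      + Real.sin (𝔅.lam k * t) • (jMap Z (𝔅.B k) : 𝔫)) t := by
  rw [funext (𝔅.eta_apply hZ k)]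
  have h := ((𝔅.hasDerivAt_sin_lam k t).smul_const (𝔅.B k : 𝔫)).add
    ((((𝔅.hasDerivAt_cos_lam k t).const_sub 1).const_mul (1 / 𝔅.lam k)).smul_const
      (jMap Z (𝔅.B k) : 𝔫))
  rw [neg_mul, neg_neg, ← mul_assoc, one_div_mul_cancel (𝔅.lam_pos k).ne', one_mul] at h
  exact h

theorem xi_mem_jacobiFields (hZ : ∀ X : 𝔫, ⁅Z, X⁆ = 0) (k : Fin M) :
    𝔅.xi k ∈ (leftInvariantMetric 𝔫).jacobiFields (centralGeodesic Z)
      (contDiff_centralGeodesic Z) := by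
  refine (mem_jacobiFields_central_iff hZ _).2 ⟨?_, fun t => ?_⟩
  · rw [funext (𝔅.xi_apply hZ k)]
    fun_prop
  · rw [funext fun t => (𝔅.hasDerivAt_xi hZ k t).deriv]
    have h := (((𝔅.hasDerivAt_sin_lam k t).const_mul (-𝔅.lam k)).smul_const (𝔅.B k : 𝔫)).add
      ((𝔅.hasDerivAt_cos_lam k t).smul_const (jMap Z (𝔅.B k) : 𝔫))
    refine h.deriv.trans ?_
    simp only [map_add, map_smul, jExt_coe, 𝔅.jExt_jMap_B hZ]
    module

theorem eta_mem_jacobiFields (hZ : ∀ X : 𝔫, ⁅Z, X⁆ = 0) (k : Fin M) :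
    𝔅.eta k ∈ (leftInvariantMetric 𝔫).jacobiFields (centralGeodesic Z)
      (contDiff_centralGeodesic Z) := by
  refine (mem_jacobiFields_central_iff hZ _).2 ⟨?_, fun t => ?_⟩
  · rw [funext (𝔅.eta_apply hZ k)]
    fun_prop
  · rw [funext fun t => (𝔅.hasDerivAt_eta hZ k t).deriv]
    have h := (((𝔅.hasDerivAt_cos_lam k t).const_mul (𝔅.lam k)).smul_const (𝔅.B k : 𝔫)).add
      ((𝔅.hasDerivAt_sin_lam k t).smul_const (jMap Z (𝔅.B k) : 𝔫))
    refine h.deriv.trans ?_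
    simp only [map_add, map_smul, jExt_coe, 𝔅.jExt_jMap_B hZ]
    module

/-- Replaces the arithmetic condition by the trigonometric one that governs the 2×2 systems.
Positivity of `lam k * t₀` makes the integer supplied by the cosine positive. -/
theorem mem_resonant_iff {t₀ : ℝ} (ht₀ : 0 < t₀) (k : Fin M) :
    k ∈ 𝔅.resonant t₀ ↔ Real.cos (𝔅.lam k * t₀) = 1 := by
  have hl := 𝔅.lam_pos k
  constructor
  · rintro ⟨m, -, hm⟩
    rw [Real.cos_eq_one_iff]
    refine ⟨m, ?_⟩
    rw [hm]
    push_cast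
    field_simp
  · intro h
    obtain ⟨n, hn⟩ := (Real.cos_eq_one_iff _).1 h
    have hpos : (0 : ℝ) < n * (2 * Real.pi) := hn ▸ mul_pos hl ht₀
    have hn0 : 0 < n := by
      exact_mod_cast (pos_iff_pos_of_mul_pos hpos).2 Real.two_pi_pos
    lift n to ℕ using hn0.le
    refine ⟨n, by exact_mod_cast hn0, ?_⟩
    rw [eq_div_iff hl.ne', mul_comm t₀, ← hn]
    push_cast
    ring

theorem sin_eq_zero_of_mem_resonant {t₀ : ℝ} (ht₀ : 0 < t₀) {k : Fin M}
    (hk : k ∈ 𝔅.resonant t₀) : Real.sin (𝔅.lam k * t₀) = 0 :=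
  Real.sin_eq_zero_iff_cos_eq.2 (Or.inl ((𝔅.mem_resonant_iff ht₀ k).1 hk))

theorem span_le_jacobiFieldsVanishing (hZ : ∀ X : 𝔫, ⁅Z, X⁆ = 0) {t₀ : ℝ} (ht₀ : 0 < t₀) :
    Submodule.span ℝ (𝔅.xi '' 𝔅.resonant t₀ ∪ 𝔅.eta '' 𝔅.resonant t₀) ≤
      (leftInvariantMetric 𝔫).jacobiFieldsVanishing (centralGeodesic Z)
        (contDiff_centralGeodesic Z) t₀ := by
  rw [Submodule.span_le]
  rintro _ (⟨k, hk, rfl⟩ | ⟨k, hk, rfl⟩)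
  · refine ⟨𝔅.xi_mem_jacobiFields hZ k, 𝔅.xi_zero hZ k, ?_⟩
    simp [𝔅.xi_apply hZ, (𝔅.mem_resonant_iff ht₀ k).1 hk, 𝔅.sin_eq_zero_of_mem_resonant ht₀ hk]
  · refine ⟨𝔅.eta_mem_jacobiFields hZ k, 𝔅.eta_zero hZ k, ?_⟩
    simp [𝔅.eta_apply hZ, (𝔅.mem_resonant_iff ht₀ k).1 hk, 𝔅.sin_eq_zero_of_mem_resonant ht₀ hk]

theorem exists_coord (x : 𝔫) : ∃ (a : Fin r → ℝ) (b c : Fin M → ℝ) (z : Fin s → ℝ),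
    x = (∑ i, a i • (𝔅.A i : 𝔫) + ∑ i, z i • 𝔅.C i)
      + ∑ k, (b k • (𝔅.B k : 𝔫) + c k • (jMap Z (𝔅.B k) : 𝔫)) := by
  let e := Module.Basis.mk 𝔅.linearIndependent 𝔅.span_eq_top.ge
  have h := e.sum_repr x
  simp only [Fintype.sum_sum_type, e, Module.Basis.mk_apply, Sum.elim_inl, Sum.elim_inr] at h
  refine ⟨fun i => e.repr x (.inl i), fun k => e.repr x (.inr (.inl k)),
    fun k => e.repr x (.inr (.inr (.inl k))), fun i => e.repr x (.inr (.inr (.inr i))), ?_⟩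
  rw [Finset.sum_add_distrib]
  refine h.symm.trans ?_
  abel

theorem coord_eq_zero {a : Fin r → ℝ} {b c : Fin M → ℝ} {z : Fin s → ℝ}
    (h : (∑ i, a i • (𝔅.A i : 𝔫) + ∑ i, z i • 𝔅.C i)
      + ∑ k, (b k • (𝔅.B k : 𝔫) + c k • (jMap Z (𝔅.B k) : 𝔫)) = 0) :
    (∀ i, a i = 0) ∧ (∀ k, b k = 0) ∧ (∀ k, c k = 0) ∧ ∀ i, z i = 0 := by
  have hli := Fintype.linearIndependent_iff.1 𝔅.linearIndependent
    (Sum.elim a (Sum.elim b (Sum.elim c z))) (by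
      simp only [Fintype.sum_sum_type, Sum.elim_inl, Sum.elim_inr]
      rw [Finset.sum_add_distrib] at h
      refine Eq.trans ?_ h
      abel)
  exact ⟨fun i => hli (.inl i), fun k => hli (.inr (.inl k)),
    fun k => hli (.inr (.inr (.inl k))), fun i => hli (.inr (.inr (.inr i)))⟩

/-- The derivatives at `0` are `j(Z)B_k` and `lam_k • B_k`, nonzero multiples of distinct basis
vectors. -/
theorem linearIndependent_xi_eta (hZ : ∀ X : 𝔫, ⁅Z, X⁆ = 0) :
    LinearIndependent ℝ (Sum.elim 𝔅.xi 𝔅.eta) := by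
  rw [Fintype.linearIndependent_iff]
  intro g hg
  simp only [Fintype.sum_sum_type, Sum.elim_inl, Sum.elim_inr] at hg
  rw [← Finset.sum_add_distrib] at hg
  have hd := HasDerivAt.sum (u := Finset.univ) (x := (0 : ℝ)) fun k _ =>
    ((𝔅.hasDerivAt_xi hZ k 0).const_smul (g (.inl k))).add
      ((𝔅.hasDerivAt_eta hZ k 0).const_smul (g (.inr k)))
  rw [hg] at hd
  have h0 := hd.unique (hasDerivAt_const (0 : ℝ) (0 : 𝔫))
  obtain ⟨-, h1, h2, -⟩ := 𝔅.coord_eq_zero (a := 0) (z := 0)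
    (b := fun k => g (.inr k) * 𝔅.lam k) (c := fun k => g (.inl k)) (by
      rw [← h0]
      simp [smul_smul, add_comm])
  rintro (k | k)
  · exact h2 k
  · exact (mul_eq_zero.1 (h1 k)).resolve_right (𝔅.lam_pos k).ne'

/-- Every Jacobi field along the central geodesic which vanishes at `0` is the sum of a linear
field and a combination of the fields `xi` and `eta`. -/
theorem exists_eq_of_mem_jacobiFields (hZ : ∀ X : 𝔫, ⁅Z, X⁆ = 0) {Y : ℝ → 𝔫}
    (hY : Y ∈ (leftInvariantMetric 𝔫).jacobiFields (centralGeodesic Z)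
      (contDiff_centralGeodesic Z)) (h0 : Y 0 = 0) :
    ∃ (a : Fin r → ℝ) (p q : Fin M → ℝ) (z : Fin s → ℝ),
      Y = (fun t => t • (∑ i, a i • (𝔅.A i : 𝔫) + ∑ i, z i • 𝔅.C i))
        + ∑ k, (p k • 𝔅.eta k + q k • 𝔅.xi k) := by
  obtain ⟨a, b, c, z, hv⟩ := 𝔅.exists_coord (deriv Y 0)
  -- Coefficients match initial velocities: `η_k'(0) = lam_k • B_k` explains the division, and
  -- `ξ_k'(0) = j(Z)B_k`. The difference from `Y` then has zero initial data.
  refine ⟨a, fun k => b k / 𝔅.lam k, c, z, ?_⟩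
  set ℓ := ∑ i, a i • (𝔅.A i : 𝔫) + ∑ i, z i • 𝔅.C i
  have hℓ : jExt Z ℓ = 0 := by
    simp [ℓ, 𝔅.jExt_A, 𝔅.jExt_C]
  set P : ℝ → 𝔫 := ∑ k, ((b k / 𝔅.lam k) • 𝔅.eta k + c k • 𝔅.xi k)
  have hP : P ∈ (leftInvariantMetric 𝔫).jacobiFields (centralGeodesic Z)
      (contDiff_centralGeodesic Z) :=
    Submodule.sum_mem _ fun k _ => Submodule.add_mem _
      (Submodule.smul_mem _ _ (𝔅.eta_mem_jacobiFields hZ k))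
      (Submodule.smul_mem _ _ (𝔅.xi_mem_jacobiFields hZ k))
  have hP0 : P 0 = 0 := by
    simp [P, 𝔅.xi_zero hZ, 𝔅.eta_zero hZ]
  have hPd : HasDerivAt P (∑ k, (b k • (𝔅.B k : 𝔫) + c k • (jMap Z (𝔅.B k) : 𝔫))) 0 := by
    have hd := HasDerivAt.sum (u := Finset.univ) (x := (0 : ℝ)) fun k _ =>
      ((𝔅.hasDerivAt_eta hZ k 0).const_smul (b k / 𝔅.lam k)).add
        ((𝔅.hasDerivAt_xi hZ k 0).const_smul (c k))
    refine hd.congr_deriv (Finset.sum_congr rfl fun k _ => ?_)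
    simp [smul_smul, div_mul_cancel₀ _ (𝔅.lam_pos k).ne']
  have hYd : HasDerivAt Y (deriv Y 0) 0 :=
    (((mem_jacobiFields_central_iff hZ Y).1 hY).1.differentiable (by simp) 0).hasDerivAt
  have hLd : HasDerivAt (fun t : ℝ => t • ℓ) ℓ 0 := by
    simpa using (hasDerivAt_id (0 : ℝ)).smul_const ℓ
  rw [← sub_eq_zero]
  refine eq_zero_of_mem_jacobiFields_central hZ (Submodule.sub_mem _ hY
    (Submodule.add_mem _ (smul_mem_jacobiFields_central hZ hℓ) hP)) ?_ ?_
  · simp [h0, hP0]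
  · rw [(hYd.sub (hLd.add hPd)).deriv, hv, sub_self]

theorem jacobiFieldsVanishing_eq_span (hZ : ∀ X : 𝔫, ⁅Z, X⁆ = 0) {t₀ : ℝ} (ht₀ : 0 < t₀) :
    (leftInvariantMetric 𝔫).jacobiFieldsVanishing (centralGeodesic Z)
        (contDiff_centralGeodesic Z) t₀ =
      Submodule.span ℝ (𝔅.xi '' 𝔅.resonant t₀ ∪ 𝔅.eta '' 𝔅.resonant t₀) := by
  refine le_antisymm ?_ (𝔅.span_le_jacobiFieldsVanishing hZ ht₀)
  rintro Y ⟨hY, h0, h1⟩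
  obtain ⟨a, p, q, z, rfl⟩ := 𝔅.exists_eq_of_mem_jacobiFields hZ hY h0
  -- These are the coordinates of `Y t₀` in the adapted basis, all zero by `h1`.
  have hcoord := 𝔅.coord_eq_zero (a := fun i => t₀ * a i) (z := fun i => t₀ * z i)
    (b := fun k => p k * Real.sin (𝔅.lam k * t₀) + q k * (Real.cos (𝔅.lam k * t₀) - 1))
    (c := fun k => p k * (1 / 𝔅.lam k * (1 - Real.cos (𝔅.lam k * t₀)))
      + q k * (1 / 𝔅.lam k * Real.sin (𝔅.lam k * t₀))) (by
      rw [← h1]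
      simp only [Pi.add_apply, Finset.sum_apply, Pi.smul_apply, 𝔅.xi_apply hZ, 𝔅.eta_apply hZ,
        smul_add, Finset.smul_sum, smul_smul]
      congr 1
      refine Finset.sum_congr rfl fun k _ => ?_
      module)
  obtain ⟨ha, hb, hc, hz⟩ := hcoord
  have ha' : ∀ i, a i = 0 := fun i => (mul_eq_zero.1 (ha i)).resolve_left ht₀.ne'
  have hz' : ∀ i, z i = 0 := fun i => (mul_eq_zero.1 (hz i)).resolve_left ht₀.ne'
  simp only [ha', hz', zero_smul, Finset.sum_const_zero, add_zero, smul_zero]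
  refine Submodule.add_mem _ (Submodule.zero_mem _) (Submodule.sum_mem _ fun k _ => ?_)
  by_cases hk : k ∈ 𝔅.resonant t₀
  · exact Submodule.add_mem _
      (Submodule.smul_mem _ _ (Submodule.subset_span (Or.inr ⟨k, hk, rfl⟩)))
      (Submodule.smul_mem _ _ (Submodule.subset_span (Or.inl ⟨k, hk, rfl⟩)))
  · rw [𝔅.mem_resonant_iff ht₀] at hk
    have hb := hb k
    have hc : p k * (1 - Real.cos (𝔅.lam k * t₀)) + q k * Real.sin (𝔅.lam k * t₀) = 0 := by
      have h := hc k
      have hl := (𝔅.lam_pos k).ne'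
      field_simp at h
      linarith
    have hlt : 0 < 1 - Real.cos (𝔅.lam k * t₀) :=
      sub_pos.2 (lt_of_le_of_ne (Real.cos_le_one _) hk)
    set S := Real.sin (𝔅.lam k * t₀)
    set D := 1 - Real.cos (𝔅.lam k * t₀)
    -- The system is `p S - q D = 0`, `p D + q S = 0`, with determinant `S² + D²`; it is nonzero
    -- since `D > 0` off resonance.
    have hdet : S ^ 2 + D ^ 2 ≠ 0 := by positivity
    have hp : p k = 0 := by
      refine (mul_eq_zero.1 (?_ : p k * (S ^ 2 + D ^ 2) = 0)).resolve_right hdet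
      linear_combination S * hb + D * hc
    have hq : q k = 0 := by
      refine (mul_eq_zero.1 (?_ : q k * (S ^ 2 + D ^ 2) = 0)).resolve_right hdet
      linear_combination S * hc - D * hb
    simp [hp, hq]

/-- The spanning fields are a subfamily of an independent family, with one `ξ_k` and one `η_k` for
each resonant `k`, so the dimension is twice the number of resonant indices. -/
theorem even_conjugateMultiplicity (𝔅 : AdaptedBasis Z r M s) (hZ : ∀ X : 𝔫, ⁅Z, X⁆ = 0)
    {t₀ : ℝ} (ht₀ : 0 < t₀) :
    Even ((leftInvariantMetric 𝔫).conjugateMultiplicity (centralGeodesic Z)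
      (contDiff_centralGeodesic Z) t₀) := by
  classical
  have hrange : 𝔅.xi '' 𝔅.resonant t₀ ∪ 𝔅.eta '' 𝔅.resonant t₀ =
      Set.range (Sum.elim 𝔅.xi 𝔅.eta ∘
        Sum.map (Subtype.val : 𝔅.resonant t₀ → _) (Subtype.val : 𝔅.resonant t₀ → _)) := by
    rw [Sum.elim_comp_map, Set.Sum.elim_range, Set.range_comp, Set.range_comp,
      Subtype.range_coe]
  have hli := (𝔅.linearIndependent_xi_eta hZ).comp
    (Sum.map (Subtype.val : 𝔅.resonant t₀ → _) (Subtype.val : 𝔅.resonant t₀ → _))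
    (Subtype.val_injective.sumMap Subtype.val_injective)
  rw [RiemannianMetric.conjugateMultiplicity, 𝔅.jacobiFieldsVanishing_eq_span hZ ht₀, hrange,
    finrank_span_eq_card hli, Fintype.card_sum]
  exact ⟨_, rfl⟩

end AdaptedBasis

end Adapted

end CentralConjugate

theorem proposition4p4 {𝔫 : Type*} [CentralConjugate.MetricLieAlgebra 𝔫]
    [FiniteDimensional ℝ 𝔫] [CentralConjugate.IsTwoStepNilpotent 𝔫]
    (Z : 𝔫) (hZ : Z ∈ ⁅(⊤ : LieIdeal ℝ 𝔫), (⊤ : LieIdeal ℝ 𝔫)⁆) (hZ0 : Z ≠ 0)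
    (t₀ : ℝ) (ht₀ : 0 < t₀) :
    (∃ r M s : ℕ, Nonempty (CentralConjugate.AdaptedBasis Z r M s)) ∧
    (∀ (r M s : ℕ) (𝔅 : CentralConjugate.AdaptedBasis Z r M s),
      (CentralConjugate.leftInvariantMetric 𝔫).jacobiFieldsVanishing
          (CentralConjugate.centralGeodesic Z) (CentralConjugate.contDiff_centralGeodesic Z) t₀ =
        Submodule.span ℝ (𝔅.xi '' 𝔅.resonant t₀ ∪ 𝔅.eta '' 𝔅.resonant t₀)) ∧
    Even ((CentralConjugate.leftInvariantMetric 𝔫).conjugateMultiplicity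
      (CentralConjugate.centralGeodesic Z) (CentralConjugate.contDiff_centralGeodesic Z) t₀) :=
  by
    have hcentral := CentralConjugate.lie_eq_zero_of_mem_commutator hZ
    -- The multiplicity does not depend on a basis, so evenness may be computed in this chosen one.
    obtain ⟨r, M, s, ⟨𝔅⟩⟩ := CentralConjugate.exists_adaptedBasis hcentral
    exact ⟨⟨r, M, s, ⟨𝔅⟩⟩, fun _ _ _ 𝔅' => 𝔅'.jacobiFieldsVanishing_eq_span hcentral ht₀,
      𝔅.even_conjugateMultiplicity hcentral ht₀⟩
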